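/- Let $K$ be a field, let $n_1<n_2<n_3<n_4$ be positive integers with $\gcd(n_1,n_2,n_3,n_4)=1$, and let $C\subset\mathbb{A}^4(K)$ be the monomial curve parametrized by $x_i=t^{n_i}$ ($1\le i\le 4$). Let $I(C)$ be its toric ideal, i.e. the kernel of the $K$-algebra homomorphism $K[x_1,x_2,x_3,x_4]\to K[t]$, $x_i\mapsto t^{n_i}$. Suppose that $I(C)$ is minimally generated by the five binomials $$f_1=x_1^{a_1}-x_2^{a_{12}}x_3^{a_{13}},\quad f_2=x_2^{a_2}-x_3^{a_{23}}x_4^{a_{24}},\quad f_3=x_3^{a_3}-x_1^{a_{31}}x_4^{a_{34}},$$ $$f_4=x_4^{a_4}-x_1^{a_{41}}x_2^{a_{42}},\quad f_5=x_1^{a_{41}}x_3^{a_{23}}-x_2^{a_{12}}x_4^{a_{34}},$$ where the exponents are integers with $0<a_{ij}<a_j$ for every $a_{ij}$ that occurs (this is case 2(a) of the classification of non-complete intersection Gorenstein monomial curves in $\mathbb{A}^4(K)$). Assume moreover that $a_{24}<a_{34}$ and $a_{13}\le a_{23}$. For a nonzero polynomial $f$ let $f_*$ be its nonzero homogeneous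 summand of least total degree, and let $I(C)_*$ be the ideal generated by all $f_*$ with $0\ne f\in I(C)$. Then $C$ has Cohen–Macaulay tangent cone at the origin, i.e. the ring $K[x_1,x_2,x_3,x_4]/I(C)_*$ is Cohen–Macaulay, if and only if the following three inequalities hold: 1. $a_3\le a_{31}+a_{34}$, 2. $a_{12}+a_{34}\le a_{41}+a_{23}$, 3. $a_2+a_{12}\le a_1+a_{23}-a_{13}+a_{24}$. -/

import Mathlib

noncomputable section

/-- The toric ideal `I(C)` of the affine monomial curve `x_i = t ^ (n i)`: the kernel of the
`K`-algebra homomorphism `K[x_1, ..., x_d] → K[t]` with `x_i ↦ t ^ (n i)`. -/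
def toricIdeal (K : Type*) [Field K] {d : ℕ} (n : Fin d → ℕ) : Ideal (MvPolynomial (Fin d) K) :=
  RingHom.ker (MvPolynomial.aeval (R := K) (fun i => (Polynomial.X : Polynomial K) ^ n i))

/-- The least degree of a nonzero homogeneous summand of `f` (and `0` for `f = 0`). -/
def leastDegree {σ K : Type*} [CommRing K] (f : MvPolynomial σ K) : ℕ :=
  sInf {e : ℕ | MvPolynomial.homogeneousComponent e f ≠ 0}

/-- The initial form `f_*`: the homogeneous summand of `f` of least degree. -/
def initialForm {σ K : Type*} [CommRing K] (f : MvPolynomial σ K) : MvPolynomial σ K :=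
  MvPolynomial.homogeneousComponent (leastDegree f) f

/-- The ideal `I_*` generated by the initial forms `f_*` of all `f ∈ I`. -/
def initialFormIdeal {σ K : Type*} [CommRing K] (I : Ideal (MvPolynomial σ K)) :
    Ideal (MvPolynomial σ K) :=
  Ideal.span (initialForm '' (I : Set (MvPolynomial σ K)))

/-- The coordinate ring `K[x_1, ..., x_d] / I(C)_*` of the tangent cone at the origin of the
monomial curve `C`. -/
abbrev TangentConeRing (K : Type*) [Field K] {d : ℕ} (n : Fin d → ℕ) : Type _ :=
  MvPolynomial (Fin d) K ⧸ initialFormIdeal (toricIdeal K n)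

/-- A Noetherian local ring is Cohen-Macaulay if its maximal ideal contains a regular sequence
whose length is the Krull dimension (equivalently, depth equals dimension). -/
def IsCohenMacaulayLocalRing (R : Type*) [CommRing R] [IsLocalRing R] : Prop :=
  IsNoetherianRing R ∧
    ∃ rs : List R, (∀ r ∈ rs, r ∈ IsLocalRing.maximalIdeal R) ∧
      RingTheory.Sequence.IsRegular R rs ∧ ((rs.length : ℕ∞) : WithBot ℕ∞) = ringKrullDim R

/-- A Noetherian ring is Cohen-Macaulay if all its localizations at maximal ideals are. -/
def IsCohenMacaulayRing (R : Type*) [CommRing R] : Prop :=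
  IsNoetherianRing R ∧
    ∀ (m : Ideal R) [m.IsMaximal], IsCohenMacaulayLocalRing (Localization.AtPrime m)

/-- The monomial curve has Cohen-Macaulay tangent cone at the origin. -/
def HasCohenMacaulayTangentCone (K : Type*) [Field K] {d : ℕ} (n : Fin d → ℕ) : Prop :=
  IsCohenMacaulayRing (TangentConeRing K n)

/-- The family `f` generates the ideal `I`, and no member of the family can be left out. -/
def IsMinimalGeneratingFamily {R ι : Type*} [CommRing R] (f : ι → R) (I : Ideal R) : Prop :=
  Ideal.span (Set.range f) = I ∧ ∀ i, Ideal.span (f '' {i}ᶜ) ≠ I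

open MvPolynomial in
/-- The five binomials `f_1, ..., f_5` of case 2(a); the variables `x_1, x_2, x_3, x_4` are
`X 0, X 1, X 2, X 3`. -/
def case2aBinomials (K : Type*) [Field K]
    (a₁ a₂ a₃ a₄ a₁₂ a₁₃ a₂₃ a₂₄ a₃₁ a₃₄ a₄₁ a₄₂ : ℕ) : Fin 5 → MvPolynomial (Fin 4) K :=
  ![X 0 ^ a₁ - X 1 ^ a₁₂ * X 2 ^ a₁₃,
    X 1 ^ a₂ - X 2 ^ a₂₃ * X 3 ^ a₂₄,
    X 2 ^ a₃ - X 0 ^ a₃₁ * X 3 ^ a₃₄,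
    X 3 ^ a₄ - X 0 ^ a₄₁ * X 1 ^ a₄₂,
    X 0 ^ a₄₁ * X 2 ^ a₂₃ - X 1 ^ a₁₂ * X 3 ^ a₃₄]

end

/-! Initial forms of elements of `I(C)` kill every monomial that is beaten in degree by another of
the same weight, and identify the monomials of largest degree within one weight. So the tangent cone
has a basis indexed by the semigroup of the `n i`, in which a product of two basis elements is a
basis element or zero. The variables other than x_1 are nilpotent there, so the ring is integral
over K[x_1], and it is Cohen-Macaulay exactly when x_1 is a nonzerodivisor, that is, when
multiplication by x_1 preserves maximality of degree (`hasCohenMacaulayTangentCone_iff`).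

Necessity: in each inequality the right side is the degree of some x_1 * u with u alone in its
weight (`eq_of_weight_eq`), hence of maximal degree; the left side is the degree of another monomial
of the weight of x_1 * u.

Sufficiency: the inequalities ensure that the moves turning an x_1-free monomial into a multiple of
x_1 never lower the degree. The monomials admitting no such move form a union of weight classes
(`iff_of_weight_eq`), so their weights contain no multiple of x_1 (`exists_pos_of_weight_eq`). -/

noncomputable section

open MvPolynomial

/-! ### Monomials of maximal degree and the tangent cone -/

/-- No monomial with the same weight as `x ^ u` has larger degree. -/
def IsMaxDegree {σ : Type*} (n : σ → ℕ) (u : σ →₀ ℕ) : Prop :=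
  ∀ v, Finsupp.weight n v = Finsupp.weight n u → v.degree ≤ u.degree

theorem IsMaxDegree.of_weight_eq {σ : Type*} {n : σ → ℕ} {u v : σ →₀ ℕ} (hu : IsMaxDegree n u)
    (hw : Finsupp.weight n v = Finsupp.weight n u) (hd : u.degree ≤ v.degree) :
    IsMaxDegree n v :=
  fun w h => (hu w (h.trans hw)).trans hd

theorem IsMaxDegree.degree_eq {σ : Type*} {n : σ → ℕ} {u v : σ →₀ ℕ} (hu : IsMaxDegree n u)
    (hv : IsMaxDegree n v) (hw : Finsupp.weight n v = Finsupp.weight n u) :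
    v.degree = u.degree :=
  le_antisymm (hu v hw) (hv u hw.symm)

theorem IsMaxDegree.of_add {σ : Type*} {n : σ → ℕ} {u w : σ →₀ ℕ} (h : IsMaxDegree n (w + u)) :
    IsMaxDegree n u := by
  intro v hv
  have := h (w + v) (by simp [hv])
  simpa using this

section
variable {K : Type*} [Field K] {d : ℕ} (n : Fin d → ℕ)

theorem aeval_X_pow_monomial (u : Fin d →₀ ℕ) (c : K) :
    aeval (fun i => (Polynomial.X : Polynomial K) ^ n i) (monomial u c) =
      Polynomial.monomial (Finsupp.weight n u) c := by
  rw [aeval_monomial, Finsupp.weight_apply, ← Polynomial.C_mul_X_pow_eq_monomial,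
    Finsupp.prod, Finsupp.sum, ← Finset.prod_pow_eq_pow_sum]
  simp [← pow_mul, mul_comm, Polynomial.algebraMap_eq]

theorem monomial_sub_monomial_mem_toricIdeal {u v : Fin d →₀ ℕ}
    (h : Finsupp.weight n u = Finsupp.weight n v) :
    monomial u (1 : K) - monomial v 1 ∈ toricIdeal K n := by
  rw [toricIdeal, RingHom.mem_ker, map_sub]
  simp only [aeval_X_pow_monomial, h, sub_self]

theorem weight_eq_of_monomial_sub_monomial_mem_toricIdeal {u v : Fin d →₀ ℕ}
    (h : monomial u (1 : K) - monomial v 1 ∈ toricIdeal K n) :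
    Finsupp.weight n u = Finsupp.weight n v := by
  rw [toricIdeal, RingHom.mem_ker, map_sub] at h
  simp only [aeval_X_pow_monomial, sub_eq_zero] at h
  exact (Polynomial.monomial_left_inj one_ne_zero).1 h

/-- The component may be zero, so binomials need no separate check that their two terms differ. -/
theorem homogeneousComponent_mem_initialFormIdeal {σ : Type*} {I : Ideal (MvPolynomial σ K)}
    {f : MvPolynomial σ K} (hf : f ∈ I) {e : ℕ} (he : ∀ k < e, homogeneousComponent k f = 0) :
    homogeneousComponent e f ∈ initialFormIdeal I := by
  by_cases h : homogeneousComponent e f = 0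
  · rw [h]; exact zero_mem _
  · have : leastDegree f = e := by
      apply le_antisymm (Nat.sInf_le h)
      by_contra! hlt
      exact Nat.sInf_mem (s := {k | homogeneousComponent k f ≠ 0}) ⟨e, h⟩ (he _ hlt)
    exact Ideal.subset_span ⟨f, hf, by rw [initialForm, this]⟩

theorem homogeneousComponent_monomial {σ : Type*} (k : ℕ) (u : σ →₀ ℕ) (c : K) :
    homogeneousComponent k (monomial u c) = if u.degree = k then monomial u c else 0 := by
  have : (monomial u c : MvPolynomial σ K) ∈ homogeneousSubmodule σ K u.degree :=
    isHomogeneous_monomial c rfl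
  rw [homogeneousComponent_of_mem this]
  simp only [eq_comm]

open Classical in
/-- The linear map which sends a monomial of maximal degree among the monomials of its weight `s`
to `t ^ s`, and all other monomials to `0`. -/
def maxDegreeMap (K : Type*) [Field K] : MvPolynomial (Fin d) K →ₗ[K] Polynomial K :=
  (basisMonomials (Fin d) K).constr K fun u =>
    if IsMaxDegree n u then Polynomial.monomial (Finsupp.weight n u) 1 else 0

open Classical in
theorem maxDegreeMap_monomial (u : Fin d →₀ ℕ) (c : K) :
    maxDegreeMap n K (monomial u c) =
      if IsMaxDegree n u then Polynomial.monomial (Finsupp.weight n u) c else 0 := by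
  have h : (monomial u c : MvPolynomial (Fin d) K) = c • basisMonomials (Fin d) K u := by
    simp [smul_monomial]
  rw [h, map_smul, maxDegreeMap, Module.Basis.constr_basis, smul_ite, smul_zero,
    Polynomial.smul_monomial]
  simp

open Classical in
/-- Multiplication by the monomial `x ^ w` of the tangent cone, on the images under
`maxDegreeMap`. -/
def maxDegreeShift (K : Type*) [Field K] (w : Fin d →₀ ℕ) : Polynomial K →ₗ[K] Polynomial K :=
  (Polynomial.basisMonomials K).constr K fun s =>
    if ∃ u, Finsupp.weight n u = s ∧ IsMaxDegree n (w + u) then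
      Polynomial.monomial (Finsupp.weight n w + s) 1 else 0

open Classical in
theorem maxDegreeShift_monomial (w : Fin d →₀ ℕ) (s : ℕ) (c : K) :
    maxDegreeShift n K w (Polynomial.monomial s c) =
      if ∃ u, Finsupp.weight n u = s ∧ IsMaxDegree n (w + u) then
        Polynomial.monomial (Finsupp.weight n w + s) c else 0 := by
  have h : (Polynomial.monomial s c : Polynomial K) = c • Polynomial.basisMonomials K s := by
    simp [Polynomial.smul_monomial]
  rw [h, map_smul, maxDegreeShift, Module.Basis.constr_basis, smul_ite, smul_zero,
    Polynomial.smul_monomial]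
  simp

/-- `maxDegreeMap` is not multiplicative, but the image of a multiple of `f` depends only on the
image of `f`; hence its kernel is an ideal. -/
theorem maxDegreeMap_monomial_mul (w : Fin d →₀ ℕ) (c : K) (f : MvPolynomial (Fin d) K) :
    maxDegreeMap n K (monomial w c * f) = c • maxDegreeShift n K w (maxDegreeMap n K f) := by
  induction f using MvPolynomial.induction_on' with
  | add p q hp hq => simp only [mul_add, map_add, hp, hq, smul_add]
  | monomial u b =>
    rw [monomial_mul, maxDegreeMap_monomial, maxDegreeMap_monomial]
    by_cases hu : IsMaxDegree n u
    · rw [if_pos hu, maxDegreeShift_monomial]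
      -- `u` has at least the degree of any witness `v`, so the condition in the shift can be tested
      -- on `u` itself.
      have : (∃ v, Finsupp.weight n v = Finsupp.weight n u ∧ IsMaxDegree n (w + v)) ↔
          IsMaxDegree n (w + u) := by
        refine ⟨fun ⟨v, hv, hm⟩ => hm.of_weight_eq (by simp [hv]) ?_, fun h => ⟨u, rfl, h⟩⟩
        simpa using hu v hv
      by_cases hwu : IsMaxDegree n (w + u)
      · rw [if_pos hwu, if_pos (this.2 hwu), map_add, Polynomial.smul_monomial, smul_eq_mul]
      · rw [if_neg hwu, if_neg (this.not.2 hwu), smul_zero]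
    · rw [if_neg hu, if_neg (fun h => hu h.of_add)]
      simp

theorem maxDegreeMap_mul_eq_zero {f : MvPolynomial (Fin d) K} (hf : maxDegreeMap n K f = 0)
    (g : MvPolynomial (Fin d) K) : maxDegreeMap n K (g * f) = 0 := by
  induction g using MvPolynomial.induction_on' with
  | add p q hp hq => rw [add_mul, map_add, hp, hq, add_zero]
  | monomial u b => simp [maxDegreeMap_monomial_mul, hf]

/-- Let `e` be the least degree in `f`. If `e` is the maximal degree in weight `s`, all terms of `f`
of weight `s` have degree exactly `e`, so they all lie in the initial form, and their coefficients
sum to the coefficient of t^s in the image of `f`, which is zero. Otherwise no term of degree `e`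
and weight `s` is maximal. -/
theorem maxDegreeMap_initialForm {f : MvPolynomial (Fin d) K} (hf : f ∈ toricIdeal K n) :
    maxDegreeMap n K (initialForm f) = 0 := by
  classical
  have hlt : ∀ u ∈ f.support, leastDegree f ≤ u.degree := by
    intro u hu
    apply Nat.sInf_le
    intro h
    have := congrArg (coeff u) h
    rw [coeff_homogeneousComponent, if_pos rfl] at this
    exact (mem_support_iff.1 hu) (by simpa using this)
  have hsum : initialForm f = ∑ u ∈ f.support with u.degree = leastDegree f,
      monomial u (coeff u f) := by
    rw [initialForm, homogeneousComponent_apply]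
  ext s
  rw [hsum, map_sum, Finset.sum_filter, Polynomial.finsetSum_coeff, Polynomial.coeff_zero]
  by_cases hs : ∃ v, IsMaxDegree n v ∧ Finsupp.weight n v = s ∧ v.degree = leastDegree f
  · obtain ⟨v, hv, rfl, hvd⟩ := hs
    have h0 : (aeval (fun i => (Polynomial.X : Polynomial K) ^ n i) f).coeff
        (Finsupp.weight n v) = 0 := by
      rw [(RingHom.mem_ker.1 hf : aeval (fun i => (Polynomial.X : Polynomial K) ^ n i) f = 0)]
      simp
    conv at h0 in (occs := *) f => rw [f.as_sum]
    rw [map_sum, Polynomial.finsetSum_coeff] at h0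
    rw [← h0]
    refine Finset.sum_congr rfl fun u hu => ?_
    rw [aeval_X_pow_monomial, Polynomial.coeff_monomial]
    by_cases hw : Finsupp.weight n u = Finsupp.weight n v
    · have hud : v.degree ≤ u.degree := by rw [hvd]; exact hlt u hu
      have hum := hv.of_weight_eq hw hud
      rw [if_pos (hvd ▸ hv.degree_eq hum hw), maxDegreeMap_monomial, if_pos hum,
        Polynomial.coeff_monomial]
    · rw [if_neg hw]
      split_ifs
      · rw [maxDegreeMap_monomial]
        split_ifs
        · rw [Polynomial.coeff_monomial, if_neg hw]
        · simp
      · simp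
  · refine Finset.sum_eq_zero fun u _ => ?_
    split_ifs with hd
    · rw [maxDegreeMap_monomial]
      split_ifs with hm
      · rw [Polynomial.coeff_monomial, if_neg (fun h => hs ⟨u, hm, h, hd⟩)]
      · simp
    · simp

theorem monomial_mem_initialFormIdeal {u : Fin d →₀ ℕ} (hu : ¬ IsMaxDegree n u) (c : K) :
    monomial u c ∈ initialFormIdeal (toricIdeal K n) := by
  simp only [IsMaxDegree, not_forall, not_le] at hu
  obtain ⟨v, hw, hd⟩ := hu
  have h := homogeneousComponent_mem_initialFormIdeal (e := u.degree)
    (monomial_sub_monomial_mem_toricIdeal (K := K) n hw.symm) (fun k hk => by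
      rw [map_sub, homogeneousComponent_monomial, homogeneousComponent_monomial,
        if_neg (by omega), if_neg (by omega), sub_zero])
  rw [map_sub, homogeneousComponent_monomial, homogeneousComponent_monomial,
        if_pos rfl, if_neg (by omega), sub_zero] at h
  simpa [C_mul_monomial] using Ideal.mul_mem_left _ (C c) h

theorem monomial_sub_monomial_mem_initialFormIdeal {u v : Fin d →₀ ℕ}
    (hw : Finsupp.weight n u = Finsupp.weight n v) (hd : u.degree = v.degree) (c : K) :
    monomial u c - monomial v c ∈ initialFormIdeal (toricIdeal K n) := by
  have h := homogeneousComponent_mem_initialFormIdeal (e := u.degree)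
    (monomial_sub_monomial_mem_toricIdeal (K := K) n hw) (fun k hk => by
      rw [map_sub, homogeneousComponent_monomial, homogeneousComponent_monomial,
        if_neg (by omega), if_neg (by omega), sub_zero])
  rw [map_sub, homogeneousComponent_monomial, homogeneousComponent_monomial,
        if_pos rfl, if_pos hd.symm] at h
  simpa [C_mul_monomial, mul_sub] using Ideal.mul_mem_left _ (C c) h

open Classical in
/-- A linear section of `maxDegreeMap` over its image. -/
def maxDegreeSection (K : Type*) [Field K] : Polynomial K →ₗ[K] MvPolynomial (Fin d) K :=
  (Polynomial.basisMonomials K).constr K fun s =>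
    if h : ∃ u, IsMaxDegree n u ∧ Finsupp.weight n u = s then monomial h.choose 1 else 0

/-- Modulo the initial ideal a polynomial is determined by its image under `maxDegreeMap`, so the
kernel is no larger than the ideal. -/
theorem sub_maxDegreeSection_mem (f : MvPolynomial (Fin d) K) :
    f - maxDegreeSection n K (maxDegreeMap n K f) ∈ initialFormIdeal (toricIdeal K n) := by
  induction f using MvPolynomial.induction_on' with
  | add p q hp hq =>
    convert add_mem hp hq using 1
    simp only [map_add]; ring
  | monomial u c =>
    rw [maxDegreeMap_monomial]
    split_ifs with hu
    · have h : (Polynomial.monomial (Finsupp.weight n u) c : Polynomial K) =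
          c • Polynomial.basisMonomials K (Finsupp.weight n u) := by
        simp [Polynomial.smul_monomial]
      have hex : ∃ v, IsMaxDegree n v ∧ Finsupp.weight n v = Finsupp.weight n u := ⟨u, hu, rfl⟩
      rw [h, map_smul, maxDegreeSection, Module.Basis.constr_basis, dif_pos hex, smul_monomial,
        smul_eq_mul, mul_one]
      exact monomial_sub_monomial_mem_initialFormIdeal n hex.choose_spec.2.symm
        (hex.choose_spec.1.degree_eq hu hex.choose_spec.2.symm) c
    · simpa using monomial_mem_initialFormIdeal n hu c

/-- `maxDegreeMap` identifies the tangent cone of a monomial curve with a space of polynomials. -/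
theorem mem_initialFormIdeal_toricIdeal_iff (f : MvPolynomial (Fin d) K) :
    f ∈ initialFormIdeal (toricIdeal K n) ↔ maxDegreeMap n K f = 0 := by
  constructor
  · intro hf
    refine Submodule.span_induction ?_ (map_zero _) ?_ ?_ hf
    · rintro _ ⟨g, hg, rfl⟩
      exact maxDegreeMap_initialForm n hg
    · intro p q _ _ hp hq
      rw [map_add, hp, hq, add_zero]
    · intro g p _ hp
      exact maxDegreeMap_mul_eq_zero n hp g
  · intro hf
    simpa [hf] using sub_maxDegreeSection_mem n f
end

/-! ### Cohen-Macaulay rings in dimension one -/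

/-- A Noetherian ring that is integral and torsion-free over a principal ideal domain which is
not a field is Cohen-Macaulay. -/
theorem isCohenMacaulayRing_of_isIntegral_of_torsionFree {R G : Type*} [CommRing R] [IsDomain R]
    [IsPrincipalIdealRing R] (hR : ¬ IsField R) [CommRing G] [IsNoetherianRing G] [Algebra R G]
    [Algebra.IsIntegral R G]
    (hreg : ∀ p : R, p ≠ 0 → algebraMap R G p ∈ nonZeroDivisors G) :
    IsCohenMacaulayRing G := by
  refine ⟨inferInstance, fun m hm => ⟨IsLocalization.isNoetherianRing m.primeCompl _ inferInstance,
    ?_⟩⟩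
  have hc : (m.comap (algebraMap R G)).IsMaximal :=
    Ideal.isMaximal_comap_of_isIntegral_of_isMaximal m
  obtain ⟨p, hpm, hp0⟩ : ∃ p ∈ m.comap (algebraMap R G), p ≠ 0 := by
    have : m.comap (algebraMap R G) ≠ ⊥ := Ring.ne_bot_of_isMaximal_of_not_isField hc hR
    exact (Submodule.ne_bot_iff _).1 this
  set q : G := algebraMap R G p
  have hqm : q ∈ m := hpm
  set r : Localization.AtPrime m := algebraMap G _ q with hr
  have hrm : r ∈ IsLocalRing.maximalIdeal (Localization.AtPrime m) :=
    (IsLocalization.AtPrime.to_map_mem_maximal_iff _ m q).2 hqm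
  have hrreg : r ∈ nonZeroDivisors (Localization.AtPrime m) :=
    IsLocalization.map_nonZeroDivisors_le m.primeCompl _ ⟨q, hreg p hp0, rfl⟩
  have : Nontrivial (Localization.AtPrime m ⧸ Ideal.span {r}) := by
    rw [Ideal.Quotient.nontrivial_iff, Ne, Ideal.span_singleton_eq_top]
    exact hrm
  refine ⟨[r], by simpa using hrm, ?_, ?_⟩
  · rw [IsLocalRing.isRegular_iff_isWeaklyRegular_of_subset_maximalIdeal
      (by simpa using hrm), RingTheory.Sequence.isWeaklyRegular_singleton_iff]
    intro a b hab
    have hab' : r * a = r * b := hab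
    exact (mul_cancel_left_mem_nonZeroDivisors hrreg).1 hab'
  · apply le_antisymm
    · have h1 := ringKrullDim_quotient_succ_le_of_nonZeroDivisor hrreg
      have h2 := ringKrullDim_nonneg_of_nontrivial (R := Localization.AtPrime m ⧸ Ideal.span {r})
      calc (((([r] : List _).length : ℕ∞)) : WithBot ℕ∞) = 0 + 1 := by simp
        _ ≤ _ := by gcongr
        _ ≤ _ := h1
    · rw [IsLocalization.AtPrime.ringKrullDim_eq_height m]
      -- Krull's principal ideal theorem will bound the height of `m` by one. A prime inside `m`
      -- containing `q` contracts to a nonzero, hence maximal, ideal of `R`, so by integrality it is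
      -- maximal itself.
      have hmin : m ∈ (Ideal.span {q}).minimalPrimes := by
        refine ⟨⟨hm.isPrime, (Ideal.span_singleton_le_iff_mem _).2 hqm⟩, ?_⟩
        rintro P ⟨hP, hqP⟩ hPm
        have hqP' : p ∈ P.comap (algebraMap R G) := hqP (Ideal.mem_span_singleton_self q)
        have hPc : (P.comap (algebraMap R G)).IsMaximal :=
          IsPrime.to_maximal_ideal (S := P.comap (algebraMap R G))
            (fun h => hp0 (by rw [h] at hqP'; simpa using hqP'))
        have : P.IsMaximal := Ideal.isMaximal_of_isIntegral_of_isMaximal_comap P hPc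
        exact (this.eq_of_le hm.ne_top hPm).ge
      have := Ideal.height_le_one_of_isPrincipal_of_mem_minimalPrimes _ m hmin
      simpa using this

/-- In a Cohen-Macaulay ring, no nonzero element is killed by a power of each element of a maximal
ideal that is not a minimal prime. -/
theorem IsCohenMacaulayRing.eq_zero_of_pow_mul_eq_zero {G : Type*} [CommRing G]
    (hG : IsCohenMacaulayRing G) {m P : Ideal G} [hm : m.IsMaximal] [hP : P.IsPrime] (hPm : P < m)
    {y : G} (hy : ∀ a ∈ m, ∃ k : ℕ, a ^ k * y = 0) : y = 0 := by
  obtain ⟨-, rs, hrs, hreg, hlen⟩ := hG.2 m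
  have hdim : (1 : WithBot ℕ∞) ≤ ringKrullDim (Localization.AtPrime m) := by
    rw [IsLocalization.AtPrime.ringKrullDim_eq_height m]
    have h1 : P.height + 1 ≤ m.height := Ideal.height_add_one_le_of_lt_of_isPrime hPm
    have : (1 : ℕ∞) ≤ m.height := le_trans (by simp) h1
    exact_mod_cast this
  match rs, hrs, hreg, hlen with
  | [], _, _, hlen =>
    rw [← hlen] at hdim
    exact absurd hdim (by simp)
  | r :: rs, hrs, hreg, _ =>
    have hr : r ∈ IsLocalRing.maximalIdeal (Localization.AtPrime m) := hrs r (by simp)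
    have hreg : IsSMulRegular (Localization.AtPrime m) r :=
      ((RingTheory.Sequence.isRegular_cons_iff _ _ _).1 hreg).1
    obtain ⟨a, s, rfl⟩ := IsLocalization.exists_mk'_eq m.primeCompl r
    obtain ⟨k, hk⟩ := hy a ((IsLocalization.AtPrime.mk'_mem_maximal_iff _ m a s).1 hr)
    have hy0 : algebraMap G (Localization.AtPrime m) y = 0 := by
      apply hreg.pow k
      have hpow : IsLocalization.mk' (Localization.AtPrime m) a s ^ k * algebraMap G _ y = 0 := by
        rw [← IsLocalization.mk'_pow, ← IsLocalization.mk'_one (M := m.primeCompl) _ y,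
          ← IsLocalization.mk'_mul, hk, IsLocalization.mk'_zero]
      simpa using hpow
    -- So far `y` vanishes only in the localization. Writing 1 = c * t + b with b in `m` gives b * y
    -- = y, while some power of b kills `y`.
    obtain ⟨⟨t, ht⟩, hty⟩ := (IsLocalization.map_eq_zero_iff m.primeCompl _ y).1 hy0
    replace hty : t * y = 0 := hty
    obtain ⟨c, b, hb, hcb⟩ := hm.exists_inv ht
    obtain ⟨k, hk⟩ := hy b hb
    have hby : b * y = y := by
      calc b * y = (c * t + b) * y - c * (t * y) := by ring
        _ = y := by rw [hcb, hty]; simp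
    have hpow : ∀ k : ℕ, b ^ k * y = y := fun k => by
      induction k with
      | zero => simp
      | succ k ih => rw [pow_succ, mul_assoc, hby, ih]
    rw [← hpow k, hk]

/-! ### The criterion: x_{i₀} preserves maximality of degree -/

section
variable {K : Type*} [Field K] {d : ℕ} {n : Fin d → ℕ} {i₀ : Fin d}

theorem degree_mul_le_weight (hmin : ∀ i ≠ i₀, n i₀ < n i) (u : Fin d →₀ ℕ) :
    u.degree * n i₀ ≤ Finsupp.weight n u := by
  rw [Finsupp.weight_eq_sum, Finsupp.degree_eq_sum, Finset.sum_mul]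
  refine Finset.sum_le_sum fun i _ => ?_
  rw [smul_eq_mul]
  refine Nat.mul_le_mul_left _ ?_
  rcases eq_or_ne i i₀ with rfl | h
  exacts [le_rfl, (hmin i h).le]

theorem eq_single_of_weight_eq (hmin : ∀ i ≠ i₀, n i₀ < n i) {u : Fin d →₀ ℕ}
    (h : Finsupp.weight n u = u.degree * n i₀) : u = Finsupp.single i₀ u.degree := by
  rw [Finsupp.weight_eq_sum, Finsupp.degree_eq_sum, Finset.sum_mul] at h
  have hle : ∀ i ∈ Finset.univ, u i * n i₀ ≤ u i • n i := by
    intro i _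
    rw [smul_eq_mul]
    refine Nat.mul_le_mul_left _ ?_
    rcases eq_or_ne i i₀ with rfl | h
    exacts [le_rfl, (hmin i h).le]
  have heq := (Finset.sum_eq_sum_iff_of_le hle).1 h.symm
  have hz : ∀ i ≠ i₀, u i = 0 := by
    intro i hi
    by_contra h0
    have h1 := heq i (Finset.mem_univ i)
    rw [smul_eq_mul] at h1
    exact (hmin i hi).ne (Nat.eq_of_mul_eq_mul_left (Nat.pos_of_ne_zero h0) h1)
  ext i
  rcases eq_or_ne i i₀ with rfl | hi
  · rw [Finsupp.single_eq_same, Finsupp.degree_eq_sum,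
      Finset.sum_eq_single i (fun j _ hj => hz j hj) (by simp)]
  · rw [Finsupp.single_eq_of_ne hi, hz i hi]

theorem isMaxDegree_single (hpos : 0 < n i₀) (hmin : ∀ i ≠ i₀, n i₀ < n i) (k : ℕ) :
    IsMaxDegree n (Finsupp.single i₀ k) := by
  intro v hv
  have := degree_mul_le_weight hmin v
  rw [hv, Finsupp.weight_single, smul_eq_mul] at this
  rw [Finsupp.degree_single]
  exact Nat.le_of_mul_le_mul_right this hpos

/-- A degree times `n i₀` is at most the weight, with equality only for powers of x_{i₀}. So
x_{i₀}^k is the only monomial of maximal degree in its weight, and its coefficient can be read off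
from the image. -/
theorem coeff_single_eq_zero_of_maxDegreeMap_eq_zero (hpos : 0 < n i₀)
    (hmin : ∀ i ≠ i₀, n i₀ < n i) {f : MvPolynomial (Fin d) K} (hf : maxDegreeMap n K f = 0)
    (k : ℕ) : coeff (Finsupp.single i₀ k) f = 0 := by
  classical
  have key : ∀ g : MvPolynomial (Fin d) K,
      (maxDegreeMap n K g).coeff (k * n i₀) = coeff (Finsupp.single i₀ k) g := by
    intro g
    induction g using MvPolynomial.induction_on' with
    | add p q hp hq => rw [map_add, Polynomial.coeff_add, hp, hq, coeff_add]
    | monomial u c =>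
      rw [maxDegreeMap_monomial, coeff_monomial]
      by_cases h : u = Finsupp.single i₀ k
      · subst h
        rw [if_pos (isMaxDegree_single hpos hmin k), if_pos rfl, Finsupp.weight_single,
          smul_eq_mul, Polynomial.coeff_monomial_same]
      · rw [if_neg h]
        split_ifs with hu
        · rw [Polynomial.coeff_monomial, if_neg]
          intro hw
          have hwk : Finsupp.weight n u = Finsupp.weight n (Finsupp.single i₀ k) := by
            rw [hw, Finsupp.weight_single, smul_eq_mul]
          have hd := (isMaxDegree_single hpos hmin k).degree_eq hu hwk
          rw [Finsupp.degree_single] at hd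
          have := eq_single_of_weight_eq hmin (u := u) (by rw [hw, hd])
          exact h (by rw [this, hd])
        · simp
  rw [← key, hf, Polynomial.coeff_zero]

/-- Evaluation of polynomials on the coordinate axis of the variable `x_{i₀}`. -/
def axisEval (K : Type*) [Field K] (i₀ : Fin d) : MvPolynomial (Fin d) K →ₐ[K] Polynomial K :=
  aeval fun i => if i = i₀ then Polynomial.X else 0

theorem axisEval_monomial (u : Fin d →₀ ℕ) (c : K) :
    axisEval K i₀ (monomial u c) =
      if u = Finsupp.single i₀ (u i₀) then Polynomial.monomial (u i₀) c else 0 := by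
  rw [axisEval, aeval_monomial]
  split_ifs with h
  · rw [h, Finsupp.prod_single_index (by simp)]
    simp [Polynomial.C_mul_X_pow_eq_monomial, Polynomial.algebraMap_eq]
  · have : ∃ i, i ≠ i₀ ∧ u i ≠ 0 := by
      by_contra! hc
      apply h
      ext i
      rcases eq_or_ne i i₀ with rfl | hi
      · simp
      · rw [Finsupp.single_eq_of_ne hi, hc i hi]
    obtain ⟨i, hi, hui⟩ := this
    rw [Finsupp.prod, Finset.prod_eq_zero (Finsupp.mem_support_iff.2 hui), mul_zero]
    rw [if_neg hi, zero_pow hui]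

theorem coeff_axisEval (f : MvPolynomial (Fin d) K) (k : ℕ) :
    (axisEval K i₀ f).coeff k = coeff (Finsupp.single i₀ k) f := by
  classical
  induction f using MvPolynomial.induction_on' with
  | add p q hp hq => rw [map_add, Polynomial.coeff_add, hp, hq, coeff_add]
  | monomial u c =>
    rw [axisEval_monomial, coeff_monomial]
    by_cases h : u = Finsupp.single i₀ (u i₀)
    · rw [if_pos h, Polynomial.coeff_monomial]
      refine if_congr ?_ rfl rfl
      rw [h]
      simp [(Finsupp.single_injective i₀).eq_iff]
    · rw [if_neg h, if_neg, Polynomial.coeff_zero]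
      rintro rfl
      simp at h

theorem initialFormIdeal_le_ker_axisEval (hpos : 0 < n i₀) (hmin : ∀ i ≠ i₀, n i₀ < n i) :
    ∀ f ∈ initialFormIdeal (toricIdeal K n),
      (axisEval K i₀ : MvPolynomial (Fin d) K →+* Polynomial K) f = 0 := by
  intro f hf
  ext k
  rw [mem_initialFormIdeal_toricIdeal_iff] at hf
  rw [Polynomial.coeff_zero, ← coeff_single_eq_zero_of_maxDegreeMap_eq_zero hpos hmin hf k]
  exact coeff_axisEval f k

/-- The monomial x_{i₀}^(n i) has the same weight and larger degree. -/
theorem mk_X_pow_eq_zero (hmin : ∀ i ≠ i₀, n i₀ < n i) {i : Fin d} (hi : i ≠ i₀) :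
    (Ideal.Quotient.mk (initialFormIdeal (toricIdeal K n)) (X i)) ^ n i₀ = 0 := by
  rw [← map_pow, Ideal.Quotient.eq_zero_iff_mem, X_pow_eq_monomial]
  apply monomial_mem_initialFormIdeal
  intro h
  have := h (Finsupp.single i₀ (n i)) (by simp [Finsupp.weight_single, mul_comm])
  simp only [Finsupp.degree_single] at this
  exact absurd (hmin i hi) (not_lt.2 this)

/-- Otherwise the class `y` of x^u is nonzero but killed by x_{i₀} and by powers of the other
variables, so it is torsion for the irrelevant ideal `ker ε`. That ideal is not a minimal prime,
since `ker ψ`, the prime of the x_{i₀}-axis, lies strictly below it. -/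
theorem isMaxDegree_single_add_of_hasCohenMacaulayTangentCone (hpos : 0 < n i₀)
    (hmin : ∀ i ≠ i₀, n i₀ < n i) (hCM : HasCohenMacaulayTangentCone K n) {u : Fin d →₀ ℕ}
    (hu : IsMaxDegree n u) : IsMaxDegree n (Finsupp.single i₀ 1 + u) := by
  by_contra hnot
  set I := initialFormIdeal (toricIdeal K n)
  let ψ : MvPolynomial (Fin d) K ⧸ I →+* Polynomial K :=
    Ideal.Quotient.lift I (axisEval K i₀ : MvPolynomial (Fin d) K →+* Polynomial K)
      (initialFormIdeal_le_ker_axisEval hpos hmin)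
  have hψ : ∀ f, ψ (Ideal.Quotient.mk I f) = axisEval K i₀ f := fun f => rfl
  let ε : MvPolynomial (Fin d) K ⧸ I →+* K := (Polynomial.evalRingHom 0).comp ψ
  have hεsurj : Function.Surjective ε := fun c => ⟨Ideal.Quotient.mk I (C c), by
    simp [ε, hψ, axisEval, Polynomial.algebraMap_eq]⟩
  have hm : (RingHom.ker ε).IsMaximal := RingHom.ker_isMaximal_of_surjective ε hεsurj
  have hP : (RingHom.ker ψ).IsPrime := RingHom.ker_isPrime ψ
  have hXψ : ψ (Ideal.Quotient.mk I (X i₀)) = Polynomial.X := by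
    simp [hψ, axisEval]
  have hlt : RingHom.ker ψ < RingHom.ker ε := by
    refine lt_of_le_of_ne (fun a ha => ?_) fun h => ?_
    · rw [RingHom.mem_ker] at ha ⊢
      rw [RingHom.comp_apply, ha, map_zero]
    · have : Ideal.Quotient.mk I (X i₀) ∈ RingHom.ker ε := by
        rw [RingHom.mem_ker, RingHom.comp_apply, hXψ]
        simp
      rw [← h, RingHom.mem_ker, hXψ] at this
      exact Polynomial.X_ne_zero this
  set y := Ideal.Quotient.mk I (monomial u 1) with hy
  let J : Ideal (MvPolynomial (Fin d) K ⧸ I) :=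
    Ideal.radical (LinearMap.ker (LinearMap.toSpanSingleton (MvPolynomial (Fin d) K ⧸ I) _ y))
  have hJ : ∀ a, a ∈ J ↔ ∃ k : ℕ, a ^ k * y = 0 := fun a => by
    simp [J, Ideal.mem_radical_iff]
  have hXJ : ∀ i, Ideal.Quotient.mk I (X i) ∈ J := by
    intro i
    rw [hJ]
    rcases eq_or_ne i i₀ with rfl | hi
    · refine ⟨1, ?_⟩
      rw [pow_one, hy, ← map_mul, Ideal.Quotient.eq_zero_iff_mem, X, monomial_mul, one_mul]
      exact monomial_mem_initialFormIdeal n hnot 1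
    · exact ⟨n i₀, by rw [mk_X_pow_eq_zero hmin hi, zero_mul]⟩
  -- Modulo `J`, which contains all variables, each element equals its constant term; hence `ker ε`
  -- is contained in `J`.
  have hcomp : (Ideal.Quotient.mk J).comp (Ideal.Quotient.mk I) =
      ((Ideal.Quotient.mk J).comp (Ideal.Quotient.mk I)).comp
        ((C : K →+* MvPolynomial (Fin d) K).comp (ε.comp (Ideal.Quotient.mk I))) := by
    refine MvPolynomial.ringHom_ext (fun c => ?_) fun i => ?_
    · simp [ε, hψ, axisEval, Polynomial.algebraMap_eq]
    · have h1 : ε (Ideal.Quotient.mk I (X i)) = 0 := by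
        simp only [ε, RingHom.comp_apply, hψ, axisEval, aeval_X]
        split_ifs <;> simp
      simp only [RingHom.comp_apply, h1, map_zero]
      exact Ideal.Quotient.eq_zero_iff_mem.2 (hXJ i)
  have hy0 : y = 0 := by
    refine hCM.eq_zero_of_pow_mul_eq_zero hlt fun a ha => (hJ a).1 ?_
    obtain ⟨f, rfl⟩ := Ideal.Quotient.mk_surjective a
    rw [← Ideal.Quotient.eq_zero_iff_mem]
    have := DFunLike.congr_fun hcomp f
    simp only [RingHom.comp_apply] at this
    rw [this, (RingHom.mem_ker.1 ha : ε _ = 0)]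
    simp
  rw [hy, Ideal.Quotient.eq_zero_iff_mem, mem_initialFormIdeal_toricIdeal_iff,
    maxDegreeMap_monomial, if_pos hu] at hy0
  simp at hy0

/-- Under `maxDegreeMap`, the hypothesis turns multiplication by p(x_{i₀}) into multiplication by
p(t^(n i₀)) in the domain K[t]. So the tangent cone is torsion-free over K[x_{i₀}], and it is
integral because the other variables are nilpotent. -/
theorem hasCohenMacaulayTangentCone_of_isMaxDegree_single_add (hpos : 0 < n i₀)
    (hmin : ∀ i ≠ i₀, n i₀ < n i)
    (h : ∀ u, IsMaxDegree n u → IsMaxDegree n (Finsupp.single i₀ 1 + u)) :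
    HasCohenMacaulayTangentCone K n := by
  have hiff : ∀ (k : ℕ) (u), IsMaxDegree n (Finsupp.single i₀ k + u) ↔ IsMaxDegree n u := by
    refine fun k u => ⟨fun h => h.of_add, fun hu => ?_⟩
    induction k with
    | zero => simpa using hu
    | succ k ih =>
      have := h _ ih
      rwa [← add_assoc, ← Finsupp.single_add, add_comm 1 k] at this
  have hmap : ∀ (p : Polynomial K) (f : MvPolynomial (Fin d) K),
      maxDegreeMap n K (Polynomial.aeval (X i₀) p * f) =
        Polynomial.expand K (n i₀) p * maxDegreeMap n K f := by
    intro p f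
    induction p using Polynomial.induction_on' with
    | add p q hp hq => simp only [map_add, add_mul, hp, hq]
    | monomial k c =>
      have h1 : Polynomial.aeval (X i₀ : MvPolynomial (Fin d) K) (Polynomial.monomial k c) =
          monomial (Finsupp.single i₀ k) c := by
        rw [Polynomial.aeval_monomial, X_pow_eq_monomial, algebraMap_eq, C_mul_monomial, mul_one]
      rw [h1, Polynomial.expand_monomial]
      induction f using MvPolynomial.induction_on' with
      | add p q hp hq => simp only [map_add, mul_add, hp, hq]
      | monomial u b =>
        rw [monomial_mul, maxDegreeMap_monomial, maxDegreeMap_monomial]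
        by_cases hu : IsMaxDegree n u
        · rw [if_pos hu, if_pos ((hiff k u).2 hu), Polynomial.monomial_mul_monomial, map_add,
            Finsupp.weight_single, smul_eq_mul]
        · rw [if_neg hu, if_neg ((hiff k u).not.2 hu), mul_zero]
  let φ : Polynomial K →+* TangentConeRing K n :=
    (Ideal.Quotient.mk _).comp (Polynomial.aeval (X i₀ : MvPolynomial (Fin d) K)).toRingHom
  have hφ : ∀ p, φ p = Ideal.Quotient.mk _ (Polynomial.aeval (X i₀ : MvPolynomial (Fin d) K) p) :=
    fun _ => rfl
  let _ : Algebra (Polynomial K) (TangentConeRing K n) := φ.toAlgebra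
  have halg : ∀ p, algebraMap (Polynomial K) (TangentConeRing K n) p = φ p := fun _ => rfl
  have hint : Algebra.IsIntegral (Polynomial K) (TangentConeRing K n) := by
    refine ⟨fun a => ?_⟩
    obtain ⟨f, rfl⟩ := Ideal.Quotient.mk_surjective a
    induction f using MvPolynomial.induction_on with
    | C c =>
      have : Ideal.Quotient.mk (initialFormIdeal (toricIdeal K n)) (C c) =
          algebraMap (Polynomial K) (TangentConeRing K n) (Polynomial.C c) := by
        rw [halg, hφ, Polynomial.aeval_C]; rfl
      rw [this]
      exact isIntegral_algebraMap
    | add p q hp hq => rw [map_add]; exact hp.add hq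
    | mul_X p i hp =>
      rw [map_mul]
      refine hp.mul ?_
      rcases eq_or_ne i i₀ with rfl | hi
      · have : Ideal.Quotient.mk (initialFormIdeal (toricIdeal K n)) (X i) =
            algebraMap (Polynomial K) (TangentConeRing K n) Polynomial.X := by
          rw [halg, hφ, Polynomial.aeval_X]
        rw [this]
        exact isIntegral_algebraMap
      · refine IsIntegral.of_pow hpos ?_
        rw [mk_X_pow_eq_zero hmin hi]
        exact isIntegral_zero
  refine isCohenMacaulayRing_of_isIntegral_of_torsionFree (R := Polynomial K)
    (Polynomial.not_isField K) fun p hp => ?_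
  rw [mem_nonZeroDivisors_iff_right]
  intro a ha
  obtain ⟨f, rfl⟩ := Ideal.Quotient.mk_surjective a
  rw [mul_comm, halg, hφ, ← map_mul, Ideal.Quotient.eq_zero_iff_mem,
    mem_initialFormIdeal_toricIdeal_iff, hmap, mul_eq_zero] at ha
  rw [Ideal.Quotient.eq_zero_iff_mem, mem_initialFormIdeal_toricIdeal_iff]
  exact ha.resolve_left ((Polynomial.expand_ne_zero hpos).2 hp)

/-- The tangent cone of a monomial curve is Cohen-Macaulay if and only if multiplication by the
variable of least weight preserves maximality of degree. -/
theorem hasCohenMacaulayTangentCone_iff (hpos : 0 < n i₀) (hmin : ∀ i ≠ i₀, n i₀ < n i) :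
    HasCohenMacaulayTangentCone K n ↔
      ∀ u, IsMaxDegree n u → IsMaxDegree n (Finsupp.single i₀ 1 + u) :=
  ⟨fun h _ => isMaxDegree_single_add_of_hasCohenMacaulayTangentCone hpos hmin h,
    hasCohenMacaulayTangentCone_of_isMaxDegree_single_add hpos hmin⟩
end

/-! ### Binomial moves on exponent vectors -/

/-- The functional summing the coefficients over `A` kills every monomial multiple of a generator,
hence the whole ideal. -/
theorem mem_iff_of_monomial_sub_monomial_mem_span {σ ι K : Type*} [Field K] {L R : ι → σ →₀ ℕ}
    {A : Set (σ →₀ ℕ)} (hA : ∀ i w, w + L i ∈ A ↔ w + R i ∈ A) {u v : σ →₀ ℕ}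
    (h : monomial u (1 : K) - monomial v 1 ∈
      Ideal.span (Set.range fun i => monomial (L i) (1 : K) - monomial (R i) 1)) :
    u ∈ A ↔ v ∈ A := by
  classical
  let χ : MvPolynomial σ K →ₗ[K] K :=
    (basisMonomials σ K).constr K fun u => if u ∈ A then 1 else 0
  have hχ : ∀ u c, χ (monomial u c) = if u ∈ A then c else 0 := by
    intro u c
    have : (monomial u c : MvPolynomial σ K) = c • basisMonomials σ K u := by
      simp [smul_monomial]
    rw [this, map_smul]
    simp only [χ, Module.Basis.constr_basis]
    simp
  have key : ∀ f ∈ Ideal.span (Set.range fun i => monomial (L i) (1 : K) - monomial (R i) 1),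
      ∀ g, χ (g * f) = 0 := by
    intro f hf
    refine Submodule.span_induction ?_ ?_ ?_ ?_ hf
    · rintro _ ⟨i, rfl⟩ g
      induction g using MvPolynomial.induction_on' with
      | add p q hp hq => rw [add_mul, map_add, hp, hq, add_zero]
      | monomial w c =>
        simp only [mul_sub, monomial_mul, mul_one, map_sub, hχ, hA i w, sub_self]
    · simp
    · intro p q _ _ hp hq g
      rw [mul_add, map_add, hp, hq, add_zero]
    · intro g' p _ hp g
      rw [smul_eq_mul, ← mul_assoc, hp]
  have := key _ h 1
  rw [one_mul, map_sub, hχ, hχ] at this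
  by_cases hu : u ∈ A <;> by_cases hv : v ∈ A <;> simp_all

/-- The exponent vector `(i, j, k, l)`. -/
def exponent (i j k l : ℕ) : Fin 4 →₀ ℕ := Finsupp.equivFunOnFinite.symm ![i, j, k, l]

theorem exponent_apply (i j k l : ℕ) (m : Fin 4) : exponent i j k l m = ![i, j, k, l] m := rfl

theorem exponent_eta (u : Fin 4 →₀ ℕ) : exponent (u 0) (u 1) (u 2) (u 3) = u := by
  ext m
  fin_cases m <;> rfl

theorem exponent_add (i j k l i' j' k' l' : ℕ) :
    exponent i j k l + exponent i' j' k' l' = exponent (i + i') (j + j') (k + k') (l + l') := by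
  ext m
  fin_cases m <;> rfl

theorem single_zero_add_exponent (i j k l : ℕ) :
    Finsupp.single 0 1 + exponent i j k l = exponent (i + 1) j k l := by
  ext m
  fin_cases m <;> simp [exponent_apply, add_comm]

theorem weight_exponent (n : Fin 4 → ℕ) (i j k l : ℕ) :
    Finsupp.weight n (exponent i j k l) = i * n 0 + j * n 1 + k * n 2 + l * n 3 := by
  simp [Finsupp.weight_eq_sum, Fin.sum_univ_four, exponent_apply]

theorem degree_exponent (i j k l : ℕ) : (exponent i j k l).degree = i + j + k + l := by
  simp [Finsupp.degree_eq_sum, Fin.sum_univ_four, exponent_apply]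

theorem monomial_exponent (K : Type*) [Field K] (i j k l : ℕ) :
    monomial (exponent i j k l) (1 : K) = X 0 ^ i * X 1 ^ j * X 2 ^ k * X 3 ^ l := by
  rw [monomial_eq, Finsupp.prod_fintype _ _ (fun _ => pow_zero _)]
  simp [Fin.prod_univ_four, exponent_apply]

theorem isMaxDegree_exponent_iff (n : Fin 4 → ℕ) (i j k l : ℕ) :
    IsMaxDegree n (exponent i j k l) ↔ ∀ i' j' k' l' : ℕ,
      i' * n 0 + j' * n 1 + k' * n 2 + l' * n 3 = i * n 0 + j * n 1 + k * n 2 + l * n 3 →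
      i' + j' + k' + l' ≤ i + j + k + l := by
  constructor
  · intro h i' j' k' l' hw
    have := h (exponent i' j' k' l') (by rw [weight_exponent, weight_exponent, hw])
    rwa [degree_exponent, degree_exponent] at this
  · intro h v hv
    rw [← exponent_eta v] at hv ⊢
    rw [weight_exponent, weight_exponent] at hv
    rw [degree_exponent, degree_exponent]
    exact h _ _ _ _ hv

/-! ### The five binomials of case 2(a) -/

section
variable {K : Type*} [Field K] {n : Fin 4 → ℕ} {a₁ a₂ a₃ a₄ a₁₂ a₁₃ a₂₃ a₂₄ a₃₁ a₃₄ a₄₁ a₄₂ : ℕ}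

/-- The exponent vectors of the leading terms of `case2aBinomials`. -/
def case2aLeft (a₁ a₂ a₃ a₄ a₂₃ a₄₁ : ℕ) : Fin 5 → Fin 4 →₀ ℕ :=
  ![exponent a₁ 0 0 0, exponent 0 a₂ 0 0, exponent 0 0 a₃ 0, exponent 0 0 0 a₄,
    exponent a₄₁ 0 a₂₃ 0]

/-- The exponent vectors of the trailing terms of `case2aBinomials`. -/
def case2aRight (a₁₂ a₁₃ a₂₃ a₂₄ a₃₁ a₃₄ a₄₁ a₄₂ : ℕ) : Fin 5 → Fin 4 →₀ ℕ :=
  ![exponent 0 a₁₂ a₁₃ 0, exponent 0 0 a₂₃ a₂₄, exponent a₃₁ 0 0 a₃₄, exponent a₄₁ a₄₂ 0 0,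
    exponent 0 a₁₂ 0 a₃₄]

theorem case2aBinomials_eq (m : Fin 5) :
    case2aBinomials K a₁ a₂ a₃ a₄ a₁₂ a₁₃ a₂₃ a₂₄ a₃₁ a₃₄ a₄₁ a₄₂ m =
      monomial (case2aLeft a₁ a₂ a₃ a₄ a₂₃ a₄₁ m) 1 -
        monomial (case2aRight a₁₂ a₁₃ a₂₃ a₂₄ a₃₁ a₃₄ a₄₁ a₄₂ m) 1 := by
  fin_cases m <;> simp [case2aBinomials, case2aLeft, case2aRight, monomial_exponent]

/-- A set of exponent vectors which is closed under the moves given by the five binomials is a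
union of fibres of the weight. -/
theorem iff_of_weight_eq
    (hI : Ideal.span (Set.range
      (case2aBinomials K a₁ a₂ a₃ a₄ a₁₂ a₁₃ a₂₃ a₂₄ a₃₁ a₃₄ a₄₁ a₄₂)) = toricIdeal K n)
    (A : ℕ → ℕ → ℕ → ℕ → Prop)
    (h₁ : ∀ i j k l, A (i + a₁) j k l ↔ A i (j + a₁₂) (k + a₁₃) l)
    (h₂ : ∀ i j k l, A i (j + a₂) k l ↔ A i j (k + a₂₃) (l + a₂₄))
    (h₃ : ∀ i j k l, A i j (k + a₃) l ↔ A (i + a₃₁) j k (l + a₃₄))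
    (h₄ : ∀ i j k l, A i j k (l + a₄) ↔ A (i + a₄₁) (j + a₄₂) k l)
    (h₅ : ∀ i j k l, A (i + a₄₁) j (k + a₂₃) l ↔ A i (j + a₁₂) k (l + a₃₄))
    {i j k l i' j' k' l' : ℕ}
    (hw : i * n 0 + j * n 1 + k * n 2 + l * n 3 = i' * n 0 + j' * n 1 + k' * n 2 + l' * n 3) :
    A i j k l ↔ A i' j' k' l' := by
  have hmem := monomial_sub_monomial_mem_toricIdeal (K := K) n
    (u := exponent i j k l) (v := exponent i' j' k' l') (by rwa [weight_exponent, weight_exponent])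
  rw [← hI, funext (case2aBinomials_eq (K := K))] at hmem
  refine mem_iff_of_monomial_sub_monomial_mem_span
    (A := {u | A (u 0) (u 1) (u 2) (u 3)}) (fun m w => ?_) hmem
  rw [← exponent_eta w]
  generalize w 0 = x, w 1 = y, w 2 = z, w 3 = t
  fin_cases m
  · simpa [case2aLeft, case2aRight, exponent_add, exponent_apply] using h₁ x y z t
  · simpa [case2aLeft, case2aRight, exponent_add, exponent_apply] using h₂ x y z t
  · simpa [case2aLeft, case2aRight, exponent_add, exponent_apply] using h₃ x y z t
  · simpa [case2aLeft, case2aRight, exponent_add, exponent_apply] using h₄ x y z t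
  · simpa [case2aLeft, case2aRight, exponent_add, exponent_apply] using h₅ x y z t

/-- A monomial divisible by no term of the five binomials is alone in its weight. -/
theorem eq_of_weight_eq
    (hI : Ideal.span (Set.range
      (case2aBinomials K a₁ a₂ a₃ a₄ a₁₂ a₁₃ a₂₃ a₂₄ a₃₁ a₃₄ a₄₁ a₄₂)) = toricIdeal K n)
    {i j k l : ℕ} (h₁ : i < a₁) (h₂ : j < a₂) (h₃ : k < a₃) (h₄ : l < a₄)
    (h₅ : ¬ (a₁₂ ≤ j ∧ a₁₃ ≤ k)) (h₆ : ¬ (a₂₃ ≤ k ∧ a₂₄ ≤ l)) (h₇ : ¬ (a₃₁ ≤ i ∧ a₃₄ ≤ l))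
    (h₈ : ¬ (a₄₁ ≤ i ∧ a₄₂ ≤ j)) (h₉ : ¬ (a₄₁ ≤ i ∧ a₂₃ ≤ k)) (h₁₀ : ¬ (a₁₂ ≤ j ∧ a₃₄ ≤ l))
    {i' j' k' l' : ℕ}
    (hw : i * n 0 + j * n 1 + k * n 2 + l * n 3 = i' * n 0 + j' * n 1 + k' * n 2 + l' * n 3) :
    i' = i ∧ j' = j ∧ k' = k ∧ l' = l := by
  -- The singleton is closed under the moves vacuously: neither side of any move can be this
  -- monomial.
  refine (iff_of_weight_eq hI (fun x y z t => x = i ∧ y = j ∧ z = k ∧ t = l)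
    ?_ ?_ ?_ ?_ ?_ hw).1 ⟨rfl, rfl, rfl, rfl⟩ <;> intro x y z t <;> constructor <;>
    rintro ⟨rfl, rfl, rfl, rfl⟩ <;> omega

theorem weight_eq_of_span_eq
    (hI : Ideal.span (Set.range
      (case2aBinomials K a₁ a₂ a₃ a₄ a₁₂ a₁₃ a₂₃ a₂₄ a₃₁ a₃₄ a₄₁ a₄₂)) = toricIdeal K n)
    (m : Fin 5) :
    Finsupp.weight n (case2aLeft a₁ a₂ a₃ a₄ a₂₃ a₄₁ m) =
      Finsupp.weight n (case2aRight a₁₂ a₁₃ a₂₃ a₂₄ a₃₁ a₃₄ a₄₁ a₄₂ m) := by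
  apply weight_eq_of_monomial_sub_monomial_mem_toricIdeal (K := K)
  rw [← case2aBinomials_eq, ← hI]
  exact Ideal.subset_span ⟨m, rfl⟩

/-- The bounds give |a - a'| < a', so cancelling leaves a relation p * x = q * y with p < a',
forcing p = 0. This recovers identities such as a₂ = a₁₂ + a₄₂ from the weights alone. -/
theorem eq_and_eq_of_mul_add_mul_eq {a a' b b' x y : ℕ} (hy : 0 < y) (ha : 0 < a) (ha' : a < 2 * a')
    (e : a * x + b * y = a' * x + b' * y) (h : ∀ p q : ℕ, p < a' → p * x = q * y → p = 0) :
    a = a' ∧ b = b' := by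
  have haa : a = a' := by
    rcases lt_trichotomy a a' with hlt | heq | hlt
    · obtain ⟨p, rfl⟩ := Nat.exists_eq_add_of_le hlt.le
      have hb : b' ≤ b := Nat.le_of_mul_le_mul_right (c := y) (by rw [add_mul] at e; omega) hy
      obtain ⟨q, rfl⟩ := Nat.exists_eq_add_of_le hb
      have := h p q (by omega) (by linarith only [e])
      omega
    · exact heq
    · obtain ⟨p, rfl⟩ := Nat.exists_eq_add_of_le hlt.le
      have hb : b ≤ b' := Nat.le_of_mul_le_mul_right (c := y) (by rw [add_mul] at e; omega) hy
      obtain ⟨q, rfl⟩ := Nat.exists_eq_add_of_le hb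
      have := h p q (by omega) (by linarith only [e])
      omega
  subst haa
  exact ⟨rfl, Nat.eq_of_mul_eq_mul_right hy (Nat.add_left_cancel e)⟩

/-- Each case is a move to a multiple of x_1 whose degree does not drop, by one of `c₁`, `d₄`, `d₁`,
`c₂`, `c₃`. If none applies, the weight class contains no multiple of x_1, contradicting `hw`. -/
theorem exists_pos_of_weight_eq
    (hI : Ideal.span (Set.range
      (case2aBinomials K a₁ a₂ a₃ a₄ a₁₂ a₁₃ a₂₃ a₂₄ a₃₁ a₃₄ a₄₁ a₄₂)) = toricIdeal K n)
    (e₁ : a₁ * n 0 = a₁₂ * n 1 + a₁₃ * n 2) (e₂ : a₂ * n 1 = a₂₃ * n 2 + a₂₄ * n 3)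
    (e₃ : a₃ * n 2 = a₃₁ * n 0 + a₃₄ * n 3) (e₄ : a₄ * n 3 = a₄₁ * n 0 + a₄₂ * n 1)
    (e₅ : a₄₁ * n 0 + a₂₃ * n 2 = a₁₂ * n 1 + a₃₄ * n 3)
    (s₂ : a₂ = a₁₂ + a₄₂) (s₃ : a₃ = a₁₃ + a₂₃) (s₄ : a₄ = a₂₄ + a₃₄)
    (p₁ : 0 < a₁) (p₃₁ : 0 < a₃₁) (p₄₁ : 0 < a₄₁)
    (h₁₃₂₃ : a₁₃ ≤ a₂₃) (d₁ : a₁₂ + a₁₃ ≤ a₁) (d₄ : a₄ ≤ a₄₁ + a₄₂)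
    (c₁ : a₃ ≤ a₃₁ + a₃₄) (c₂ : a₁₂ + a₃₄ ≤ a₄₁ + a₂₃)
    (c₃ : a₂ + a₁₂ ≤ a₁ + (a₂₃ - a₁₃) + a₂₄) {i j k l i' j' k' l' : ℕ}
    (hw : i * n 0 + j * n 1 + k * n 2 + l * n 3 =
      (i' + 1) * n 0 + j' * n 1 + k' * n 2 + l' * n 3) :
    ∃ x y z t : ℕ, i * n 0 + j * n 1 + k * n 2 + l * n 3 =
      (x + 1) * n 0 + y * n 1 + z * n 2 + t * n 3 ∧ i + j + k + l ≤ x + 1 + y + z + t := by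
  suffices h : ∃ x y z t : ℕ, 0 < x ∧ i * n 0 + j * n 1 + k * n 2 + l * n 3 =
      x * n 0 + y * n 1 + z * n 2 + t * n 3 ∧ i + j + k + l ≤ x + y + z + t by
    obtain ⟨x, y, z, t, hx, h⟩ := h
    obtain ⟨x, rfl⟩ : ∃ b, x = b + 1 := ⟨x - 1, by omega⟩
    exact ⟨x, y, z, t, h⟩
  by_cases g₀ : 0 < i
  · exact ⟨i, j, k, l, g₀, rfl, le_rfl⟩
  by_cases g₁ : a₃ ≤ k
  · obtain ⟨k, rfl⟩ := Nat.exists_eq_add_of_le g₁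
    exact ⟨i + a₃₁, j, k, l + a₃₄, by omega, by linarith only [e₁, e₂, e₃, e₄, e₅], by omega⟩
  by_cases g₂ : a₄ ≤ l
  · obtain ⟨l, rfl⟩ := Nat.exists_eq_add_of_le g₂
    exact ⟨i + a₄₁, j + a₄₂, k, l, by omega, by linarith only [e₁, e₂, e₃, e₄, e₅], by omega⟩
  by_cases g₃ : a₁₂ ≤ j ∧ a₁₃ ≤ k
  · obtain ⟨j, rfl⟩ := Nat.exists_eq_add_of_le g₃.1
    obtain ⟨k, rfl⟩ := Nat.exists_eq_add_of_le g₃.2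
    exact ⟨i + a₁, j, k, l, by omega, by linarith only [e₁, e₂, e₃, e₄, e₅], by omega⟩
  by_cases g₄ : a₁₂ ≤ j ∧ a₃₄ ≤ l
  · obtain ⟨j, rfl⟩ := Nat.exists_eq_add_of_le g₄.1
    obtain ⟨l, rfl⟩ := Nat.exists_eq_add_of_le g₄.2
    exact ⟨i + a₄₁, j, k + a₂₃, l, by omega, by linarith only [e₁, e₂, e₃, e₄, e₅], by omega⟩
  -- A composite move: `f₂` turns x_2^a₂ into x_3^a₂₃ x_4^a₂₄, then `f₁` replaces x_2^a₁₂ x_3^a₁₃ by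
  -- x_1^a₁.
  by_cases g₅ : a₂ + a₁₂ ≤ j
  · obtain ⟨j, rfl⟩ := Nat.exists_eq_add_of_le g₅
    obtain ⟨c, rfl⟩ : ∃ c, a₂₃ = a₁₃ + c := ⟨a₂₃ - a₁₃, by omega⟩
    exact ⟨i + a₁, j, k + c, l + a₂₄, by omega, by linarith only [e₁, e₂, e₃, e₄, e₅], by omega⟩
  -- Only `f₂` can act within this set. Its closure under `f₂` rests on `s₃`, `s₄` and a₁₃ ≤ a₂₃;
  -- both sides of every other move lie outside it.
  have := (iff_of_weight_eq hI (fun x y z t => x = 0 ∧ y < a₂ + a₁₂ ∧ z < a₃ ∧ t < a₄ ∧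
    ¬ (a₁₂ ≤ y ∧ a₁₃ ≤ z) ∧ ¬ (a₁₂ ≤ y ∧ a₃₄ ≤ t))
    (fun x y z t => by omega) (fun x y z t => by omega) (fun x y z t => by omega)
    (fun x y z t => by omega) (fun x y z t => by omega) hw).1 (by omega)
  omega

end

/-! ### The equivalence with the three inequalities -/

theorem mainTheorem5 (K : Type*) [Field K] (n : Fin 4 → ℕ)
    (hn_pos : 0 < n 0) (hn_mono : StrictMono n) (hn_gcd : Finset.univ.gcd n = 1)
    (a₁ a₂ a₃ a₄ a₁₂ a₁₃ a₂₃ a₂₄ a₃₁ a₃₄ a₄₁ a₄₂ : ℕ)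
    (h₁₂ : 0 < a₁₂ ∧ a₁₂ < a₂) (h₁₃ : 0 < a₁₃ ∧ a₁₃ < a₃)
    (h₂₃ : 0 < a₂₃ ∧ a₂₃ < a₃) (h₂₄ : 0 < a₂₄ ∧ a₂₄ < a₄)
    (h₃₁ : 0 < a₃₁ ∧ a₃₁ < a₁) (h₃₄ : 0 < a₃₄ ∧ a₃₄ < a₄)
    (h₄₁ : 0 < a₄₁ ∧ a₄₁ < a₁) (h₄₂ : 0 < a₄₂ ∧ a₄₂ < a₂)
    (hI : IsMinimalGeneratingFamily
      (case2aBinomials K a₁ a₂ a₃ a₄ a₁₂ a₁₃ a₂₃ a₂₄ a₃₁ a₃₄ a₄₁ a₄₂) (toricIdeal K n))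
    (h₂₄₃₄ : a₂₄ < a₃₄) (h₁₃₂₃ : a₁₃ ≤ a₂₃) :
    HasCohenMacaulayTangentCone K n ↔
      a₃ ≤ a₃₁ + a₃₄ ∧
      a₁₂ + a₃₄ ≤ a₄₁ + a₂₃ ∧
      a₂ + a₁₂ ≤ a₁ + (a₂₃ - a₁₃) + a₂₄ := by
  have hs := hI.1
  have e₁ : a₁ * n 0 = a₁₂ * n 1 + a₁₃ * n 2 := by
    simpa [case2aLeft, case2aRight, weight_exponent] using weight_eq_of_span_eq hs 0
  have e₂ : a₂ * n 1 = a₂₃ * n 2 + a₂₄ * n 3 := by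
    simpa [case2aLeft, case2aRight, weight_exponent] using weight_eq_of_span_eq hs 1
  have e₃ : a₃ * n 2 = a₃₁ * n 0 + a₃₄ * n 3 := by
    simpa [case2aLeft, case2aRight, weight_exponent] using weight_eq_of_span_eq hs 2
  have e₄ : a₄ * n 3 = a₄₁ * n 0 + a₄₂ * n 1 := by
    simpa [case2aLeft, case2aRight, weight_exponent] using weight_eq_of_span_eq hs 3
  have e₅ : a₄₁ * n 0 + a₂₃ * n 2 = a₁₂ * n 1 + a₃₄ * n 3 := by
    simpa [case2aLeft, case2aRight, weight_exponent] using weight_eq_of_span_eq hs 4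
  have l₁ : n 0 < n 1 := hn_mono (by decide)
  have l₂ : n 1 < n 2 := hn_mono (by decide)
  have l₃ : n 2 < n 3 := hn_mono (by decide)
  have hmin : ∀ i ≠ (0 : Fin 4), n 0 < n i := fun i hi => hn_mono (Fin.pos_of_ne_zero hi)
  rw [hasCohenMacaulayTangentCone_iff hn_pos hmin]
  constructor
  · intro hCM
    -- A monomial alone in its weight has maximal degree, hence so does its product with x_1.
    have key : ∀ {i j k l : ℕ}, (∀ i' j' k' l' : ℕ,
        i * n 0 + j * n 1 + k * n 2 + l * n 3 = i' * n 0 + j' * n 1 + k' * n 2 + l' * n 3 →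
        i' = i ∧ j' = j ∧ k' = k ∧ l' = l) → ∀ i' j' k' l' : ℕ,
        i' * n 0 + j' * n 1 + k' * n 2 + l' * n 3 =
          (i + 1) * n 0 + j * n 1 + k * n 2 + l * n 3 →
        i' + j' + k' + l' ≤ i + 1 + j + k + l := by
      intro i j k l h
      rw [← isMaxDegree_exponent_iff, ← single_zero_add_exponent]
      refine hCM _ ((isMaxDegree_exponent_iff n i j k l).2 fun i' j' k' l' hw => ?_)
      obtain ⟨rfl, rfl, rfl, rfl⟩ := h i' j' k' l' hw.symm
      exact le_rfl
    obtain ⟨b₁, rfl⟩ : ∃ b, a₁ = b + 1 := ⟨a₁ - 1, by omega⟩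
    obtain ⟨b₃₁, rfl⟩ : ∃ b, a₃₁ = b + 1 := ⟨a₃₁ - 1, by omega⟩
    obtain ⟨b₄₁, rfl⟩ : ∃ b, a₄₁ = b + 1 := ⟨a₄₁ - 1, by omega⟩
    obtain ⟨c, rfl⟩ : ∃ c, a₂₃ = a₁₃ + c := ⟨a₂₃ - a₁₃, by omega⟩
    refine ⟨?_, ?_, ?_⟩
    · have := key (i := b₃₁) (j := 0) (k := 0) (l := a₃₄) (fun i' j' k' l' hw =>
        eq_of_weight_eq hs (by omega) (by omega) (by omega) (by omega) (by omega) (by omega)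
          (by omega) (by omega) (by omega) (by omega) hw) 0 0 a₃ 0
        (by linarith only [e₃])
      omega
    · have := key (i := b₄₁) (j := 0) (k := a₁₃ + c) (l := 0) (fun i' j' k' l' hw =>
        eq_of_weight_eq hs (by omega) (by omega) (by omega) (by omega) (by omega) (by omega)
          (by omega) (by omega) (by omega) (by omega) hw) 0 a₁₂ 0 a₃₄
        (by linarith only [e₅])
      omega
    -- By `f₂` and then `f₁`, x_2^(a₂+a₁₂) has the weight of x_1^a₁ x_3^c x_4^a₂₄. Dividing the
    -- latter by x_1 leaves a monomial alone in its weight; a₂₄ < a₃₄ keeps `f₃` from applying.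
    · have := key (i := b₁) (j := 0) (k := c) (l := a₂₄) (fun i' j' k' l' hw =>
        eq_of_weight_eq hs (by omega) (by omega) (by omega) (by omega) (by omega) (by omega)
          (by omega) (by omega) (by omega) (by omega) hw) 0 (a₂ + a₁₂) 0 0
        (by linarith only [e₁, e₂])
      omega
  · rintro ⟨c₁, c₂, c₃⟩
    -- Adding `e₂` and `e₄` and substituting `e₅` cancels n 0 and n 2. The powers x_2^p with p < a₂
    -- are alone in their weight, which is the minimality needed here.
    obtain ⟨s₂, s₄⟩ : a₁₂ + a₄₂ = a₂ ∧ a₂₄ + a₃₄ = a₄ :=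
      eq_and_eq_of_mul_add_mul_eq (by omega : 0 < n 3) (by omega) (by omega)
        (by linarith only [e₂, e₄, e₅] :
          (a₁₂ + a₄₂) * n 1 + (a₂₄ + a₃₄) * n 3 = a₂ * n 1 + a₄ * n 3) fun p q hp e =>
        (eq_of_weight_eq hs (i := 0) (j := p) (k := 0) (l := 0) (i' := 0) (j' := 0) (k' := 0)
          (l' := q) (by omega) (by omega) (by omega) (by omega) (by omega) (by omega)
          (by omega) (by omega) (by omega) (by omega) (by linarith only [e])).2.1.symm
    obtain ⟨s₃, -⟩ : a₁₃ + a₂₃ = a₃ ∧ a₃₁ + a₄₁ = a₁ :=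
      eq_and_eq_of_mul_add_mul_eq hn_pos (by omega) (by omega)
        (by linarith only [e₁, e₃, e₅] :
          (a₁₃ + a₂₃) * n 2 + (a₃₁ + a₄₁) * n 0 = a₃ * n 2 + a₁ * n 0) fun p q hp e =>
        (eq_of_weight_eq hs (i := 0) (j := 0) (k := p) (l := 0) (i' := q) (j' := 0) (k' := 0)
          (l' := 0) (by omega) (by omega) (by omega) (by omega) (by omega) (by omega)
          (by omega) (by omega) (by omega) (by omega) (by linarith only [e])).2.2.1.symm
    -- This bound and `hdeg₄` hold because n 0 is the smallest weight and n 3 the largest.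
    have hdeg₁ : a₁₂ + a₁₃ ≤ a₁ := by
      refine Nat.le_of_mul_le_mul_right (c := n 0) ?_ hn_pos
      rw [e₁, add_mul]
      exact Nat.add_le_add (Nat.mul_le_mul_left _ l₁.le) (Nat.mul_le_mul_left _ (l₁.trans l₂).le)
    have hdeg₄ : a₄ ≤ a₄₁ + a₄₂ := by
      refine Nat.le_of_mul_le_mul_right (c := n 3) ?_ (by omega)
      rw [e₄, add_mul]
      exact Nat.add_le_add (Nat.mul_le_mul_left _ (l₁.trans (l₂.trans l₃)).le)
        (Nat.mul_le_mul_left _ (l₂.trans l₃).le)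
    intro u hu
    rw [← exponent_eta u] at hu ⊢
    rw [single_zero_add_exponent]
    rw [isMaxDegree_exponent_iff] at hu ⊢
    intro i j k l hw
    -- The competitor is replaced by a multiple of x_1 of no smaller degree; dividing by x_1 allows
    -- comparison with `u`.
    obtain ⟨x, y, z, t, hxw, hd⟩ := exists_pos_of_weight_eq hs e₁ e₂ e₃ e₄ e₅
      s₂.symm s₃.symm s₄.symm (by omega) h₃₁.1 h₄₁.1 h₁₃₂₃ hdeg₁ hdeg₄ c₁ c₂ c₃ hw
    have := hu x y z t (by linarith only [hxw, hw])
    omega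

end
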